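/- **Definitions.** A symmetric monoidal category $(\mathcal M,\perp,\oplus)$ is *coclosed* if for every object $B$ the functor $-\oplus B$ has a specified left adjoint $C\mapsto C\mathbin{\bullet\!-}B$ (the internal cohom), so that $\mathrm{Hom}(C,A\oplus B)\cong\mathrm{Hom}(C\mathbin{\bullet\!-}B,A)$ naturally. A *cocartesian* category is a category with chosen finite coproducts $(0,+)$, regarded as a symmetric monoidal category; it is cocartesian coclosed if this symmetric monoidal category is coclosed. A *symmetric comonoidal functor* $F$ between symmetric monoidal categories is a functor with a map $F\perp\to\perp$ and a natural transformation $F(A\oplus B)\to FA\oplus FB$ compatible with associativity, units and symmetry; a natural transformation between such functors is *comonoidal* if it is compatible with these maps. A *symmetric comonoidal adjunction* is an adjunction $F\dashv G$ with $F$ and $G$ symmetric comonoidal functors whose unit and counit are comonoidal. A *symmetric comonoidal monad* is a monad whose functor is symmetric comonoidal and whose unit and multiplication are comonoidal. A *dual LNL model* $\mathcal L:H\dashv J:\mathcal C$ consists of a symmetric monoidal coclosed category $\mathcal L$, a cocartesian coclosed category $\mathcal C$, and a symmetric comonoidal adjunction $H\dashv J$ with $H:\mathcal L\to\mathcal C$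 and $J:\mathcal C\to\mathcal L$. A *dual linear category* is a symmetric monoidal coclosed category $(\mathcal L,\perp,\oplus)$ with a symmetric comonoidal monad $(?,\eta,\mu)$, with structure maps $n_\perp:{?}\!\perp\to\perp$ and $n_{A,B}:{?}(A\oplus B)\to{?}A\oplus{?}B$, together with comonoidal natural transformations $w_A:\perp\to{?}A$ and $c_A:{?}A\oplus{?}A\to{?}A$ such that each $({?}A,w_A,c_A)$ is a commutative monoid, $w_A$ and $c_A$ are morphisms of $?$-algebras (where $\perp$ has the structure map $n_\perp$, $?A$ the structure map $\mu_A$, and ${?}A\oplus{?}A$ the structure map $n_{?A,?A}$ followed by $\mu_A\oplus\mu_A$), and every morphism of free $?$-algebras $({?}A,\mu_A)\to({?}B,\mu_B)$ is a morphism of monoids. An object $A$ of a category with finite coproducts is *subtractable* if for every object $B$ the internal cohom of $A$ by $B$ exists, i.e. there is an object $X$ with a bijection $\mathrm{Hom}(X,Y)\cong\mathrm{Hom}(A,Y+B)$ natural in $Y$. **Statement.** Any dual linear category $\mathcal L$ gives rise to a dual LNL model. More precisely, the Eilenberg–Moore category $\mathcal L^{?}$ of $?$-algebras has finite coproducts,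 and every finite coproduct of free $?$-algebras is subtractable in $\mathcal L^{?}$. Let $\mathcal C$ be either of 1. the full subcategory $\mathsf{Sub}(\mathcal L^{?})$ of $\mathcal L^{?}$ on the subtractable $?$-algebras, or 2. its full subcategory $\mathcal L^{*}_{?}$ on the finite coproducts of free $?$-algebras. Then $\mathcal C$ contains all free $?$-algebras and is cocartesian coclosed, and the adjunction $F\dashv U$ between $\mathcal L$ and $\mathcal C$, with $F(A)=({?}A,\mu_A)$ the free functor and $U(A,h_A)=A$ the forgetful functor, is a symmetric comonoidal adjunction (for suitable symmetric comonoidal structures on $F$ and $U$); thus $\mathcal L:F\dashv U:\mathcal C$ is a dual LNL model. -/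

import Mathlib

open CategoryTheory MonoidalCategory Limits

universe v u v₁ v₂ u₁ u₂

namespace DualLNL

section Comonoidal

variable {M₁ : Type u₁} [Category.{v₁} M₁] [MonoidalCategory M₁]
  {M₂ : Type u₂} [Category.{v₂} M₂] [MonoidalCategory M₂]

/-- A comonoidal (that is, oplax monoidal) functor `(F, m)` between symmetric monoidal categories is
symmetric if its structure maps `m_{X,Y} : F (X ⊕ Y) ⟶ F X ⊕ F Y` commute with the symmetries. -/
structure IsSymmetricComonoidal [SymmetricCategory M₁] [SymmetricCategory M₂]
    (F : M₁ ⥤ M₂) [F.OplaxMonoidal] : Prop where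
  braided (X Y : M₁) :
    Functor.OplaxMonoidal.δ F X Y ≫ (β_ (F.obj X) (F.obj Y)).hom =
      F.map (β_ X Y).hom ≫ Functor.OplaxMonoidal.δ F Y X

/-- A natural transformation between comonoidal functors is comonoidal if it is compatible with
their structure maps. -/
structure IsComonoidal {F G : M₁ ⥤ M₂} [F.OplaxMonoidal] [G.OplaxMonoidal] (τ : F ⟶ G) : Prop where
  unit : τ.app (𝟙_ M₁) ≫ Functor.OplaxMonoidal.η G = Functor.OplaxMonoidal.η F
  tensor (X Y : M₁) :
    τ.app (X ⊗ Y) ≫ Functor.OplaxMonoidal.δ G X Y =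
      Functor.OplaxMonoidal.δ F X Y ≫ (τ.app X ⊗ₘ τ.app Y)

/-- The structure of a symmetric comonoidal adjunction on an adjunction `F ⊣ G` between symmetric
monoidal categories: both functors are symmetric comonoidal, and the unit and the counit are
comonoidal natural transformations (composites and identities carry the usual comonoidal
structures). -/
structure SymmetricComonoidalAdjunction [SymmetricCategory M₁] [SymmetricCategory M₂]
    {F : M₁ ⥤ M₂} {G : M₂ ⥤ M₁} (adj : F ⊣ G) where
  left : F.OplaxMonoidal
  right : G.OplaxMonoidal
  left_symmetric : IsSymmetricComonoidal F
  right_symmetric : IsSymmetricComonoidal G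
  unit_comonoidal : IsComonoidal adj.unit
  counit_comonoidal : IsComonoidal adj.counit

end Comonoidal

/-- A monoidal category is coclosed if every functor `- ⊕ B` has a specified left adjoint
`C ↦ (cohom B).obj C`, the internal cohom of `C` by `B`. Thus
`Hom (C, A ⊕ B) ≅ Hom (cohom of C by B, A)`, naturally. -/
class MonoidalCoclosed (M : Type u) [Category.{v} M] [MonoidalCategory M] where
  cohom : M → M ⥤ M
  adj (B : M) : cohom B ⊣ tensorRight B

/-- A monoidal category is cocartesian if its unit is initial and the canonical maps
`X ≅ X ⊕ ⊥ ⟶ X ⊕ Y` and `Y ≅ ⊥ ⊕ Y ⟶ X ⊕ Y` exhibit `X ⊕ Y` as the coproduct of `X` and `Y`. -/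
class Cocartesian (C : Type u) [Category.{v} C] [MonoidalCategory C] where
  isInitialUnit : IsInitial (𝟙_ C)
  isCoproduct (X Y : C) :
    IsColimit (BinaryCofan.mk
      ((ρ_ X).inv ≫ X ◁ isInitialUnit.to Y) ((λ_ Y).inv ≫ isInitialUnit.to X ▷ Y))

/-- The structure of a dual linear category on a symmetric monoidal coclosed category `L`. The
symmetric monoidal structure of `L` plays the role of the cotensor `(⊕, ⊥)`. -/
structure DualLinearCategory (L : Type u) [Category.{v} L] [MonoidalCategory L]
    [SymmetricCategory L] [MonoidalCoclosed L] where
  /-- the why-not monad `?` -/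
  whyNot : Monad L
  /-- `?` is a symmetric comonoidal monad -/
  [comonoidal : whyNot.toFunctor.OplaxMonoidal]
  symmetric : IsSymmetricComonoidal whyNot.toFunctor
  unit_comonoidal : IsComonoidal whyNot.η
  mult_comonoidal : IsComonoidal whyNot.μ
  /-- each `?A` is a commutative monoid, with unit `w_A : ⊥ ⟶ ?A`
  and multiplication `c_A : ?A ⊕ ?A ⟶ ?A` -/
  [mon (A : L) : MonObj (whyNot.obj A)]
  [comm (A : L) : IsCommMonObj (whyNot.obj A)]
  /-- `w` and `c` are natural in `A` -/
  w_natural {A B : L} (f : A ⟶ B) :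
    (MonObj.one : 𝟙_ L ⟶ whyNot.obj A) ≫ whyNot.map f = MonObj.one
  c_natural {A B : L} (f : A ⟶ B) :
    (MonObj.mul : whyNot.obj A ⊗ whyNot.obj A ⟶ whyNot.obj A) ≫ whyNot.map f =
      (whyNot.map f ⊗ₘ whyNot.map f) ≫ MonObj.mul
  /-- `w` is a comonoidal natural transformation from the constant functor `A ↦ ⊥` to `?` -/
  w_comonoidal_unit :
    (MonObj.one : 𝟙_ L ⟶ whyNot.obj (𝟙_ L)) ≫ Functor.OplaxMonoidal.η whyNot.toFunctor = 𝟙 _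
  w_comonoidal_tensor (A B : L) :
    (MonObj.one : 𝟙_ L ⟶ whyNot.obj (A ⊗ B)) ≫ Functor.OplaxMonoidal.δ whyNot.toFunctor A B =
      (λ_ (𝟙_ L)).inv ≫
        ((MonObj.one : 𝟙_ L ⟶ whyNot.obj A) ⊗ₘ (MonObj.one : 𝟙_ L ⟶ whyNot.obj B))
  /-- `c` is a comonoidal natural transformation from the functor `A ↦ ?A ⊕ ?A` to `?` -/
  c_comonoidal_unit :
    (MonObj.mul : whyNot.obj (𝟙_ L) ⊗ whyNot.obj (𝟙_ L) ⟶ whyNot.obj (𝟙_ L)) ≫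
        Functor.OplaxMonoidal.η whyNot.toFunctor =
      (Functor.OplaxMonoidal.η whyNot.toFunctor ⊗ₘ Functor.OplaxMonoidal.η whyNot.toFunctor) ≫
        (λ_ (𝟙_ L)).hom
  c_comonoidal_tensor (A B : L) :
    (MonObj.mul : whyNot.obj (A ⊗ B) ⊗ whyNot.obj (A ⊗ B) ⟶ whyNot.obj (A ⊗ B)) ≫
        Functor.OplaxMonoidal.δ whyNot.toFunctor A B =
      (Functor.OplaxMonoidal.δ whyNot.toFunctor A B ⊗ₘ
          Functor.OplaxMonoidal.δ whyNot.toFunctor A B) ≫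
        tensorμ (whyNot.obj A) (whyNot.obj B) (whyNot.obj A) (whyNot.obj B) ≫
        ((MonObj.mul : whyNot.obj A ⊗ whyNot.obj A ⟶ whyNot.obj A) ⊗ₘ
          (MonObj.mul : whyNot.obj B ⊗ whyNot.obj B ⟶ whyNot.obj B))
  /-- `w_A` is a morphism of `?`-algebras, where `⊥` is an algebra by `? ⊥ ⟶ ⊥` -/
  w_algebra (A : L) :
    whyNot.map (MonObj.one : 𝟙_ L ⟶ whyNot.obj A) ≫ whyNot.μ.app A =
      Functor.OplaxMonoidal.η whyNot.toFunctor ≫ MonObj.one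
  /-- `c_A` is a morphism of `?`-algebras, where `?A ⊕ ?A` is an algebra by
  `? (?A ⊕ ?A) ⟶ ??A ⊕ ??A ⟶ ?A ⊕ ?A` -/
  c_algebra (A : L) :
    whyNot.map (MonObj.mul : whyNot.obj A ⊗ whyNot.obj A ⟶ whyNot.obj A) ≫ whyNot.μ.app A =
      Functor.OplaxMonoidal.δ whyNot.toFunctor (whyNot.obj A) (whyNot.obj A) ≫
        (whyNot.μ.app A ⊗ₘ whyNot.μ.app A) ≫ MonObj.mul
  /-- every morphism of free `?`-algebras is a morphism of monoids -/
  free_hom {A B : L} (f : whyNot.free.obj A ⟶ whyNot.free.obj B) :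
    IsMonHom (M := whyNot.obj A) (N := whyNot.obj B) f.f

/-- The structure of a dual LNL model on an adjunction `H ⊣ J` between a symmetric monoidal coclosed
category `L` and a category `C`: a choice of finite coproducts on `C`, presented as a cocartesian
symmetric monoidal structure, for which `C` is coclosed and the adjunction is symmetric
comonoidal. -/
structure DualLNLModel {L : Type u₁} [Category.{v₁} L] [MonoidalCategory L]
    [SymmetricCategory L] [MonoidalCoclosed L] {C : Type u₂} [Category.{v₂} C]
    {H : L ⥤ C} {J : C ⥤ L} (adj : H ⊣ J) where
  monoidal : MonoidalCategory C
  symmetric : SymmetricCategory C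
  cocartesian : Cocartesian C
  coclosed : MonoidalCoclosed C
  comonoidal : SymmetricComonoidalAdjunction adj

/-- An object `A` of a category with binary coproducts is subtractable if for every object `B` the
internal cohom of `A` by `B` exists, that is, an object `X` together with a bijection
`Hom (X, Y) ≅ Hom (A, Y + B)` natural in `Y`. -/
def IsSubtractable (C : Type u) [Category.{v} C] [HasBinaryCoproducts C] : ObjectProperty C :=
  fun A ↦ ∀ B : C, (coprod.functor.flip.obj B ⋙ coyoneda.obj (Opposite.op A)).IsCorepresentable

section Monad

variable {L : Type u} [Category.{v} L] (T : Monad L)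

/-- The `T`-algebras that are a finite (possibly empty) coproduct of free `T`-algebras in the
Eilenberg–Moore category. -/
def IsFiniteCoproductOfFree : ObjectProperty T.Algebra :=
  fun X ↦ ∃ (n : ℕ) (A : Fin n → L) (ι : ∀ i, T.free.obj (A i) ⟶ X),
    Nonempty (IsColimit (Cofan.mk X ι))

/-- The free/forgetful adjunction between `L` and a full subcategory of the Eilenberg–Moore category
that contains all free algebras. -/
def freeForgetAdj (P : ObjectProperty T.Algebra) (h : ∀ A : L, P (T.free.obj A)) :
    P.lift T.free h ⊣ P.ι ⋙ T.forget where
  unit := { app A := T.adj.unit.app A, naturality _ _ f := T.adj.unit.naturality f }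
  counit :=
    { app X := ObjectProperty.homMk (T.adj.counit.app X.obj)
      naturality _ _ f := by
        ext : 1
        exact T.adj.counit.naturality f.hom }
  left_triangle_components A := by
    ext : 1
    exact T.adj.left_triangle_components A
  right_triangle_components X := T.adj.right_triangle_components X.obj

end Monad

end DualLNL

namespace DualLNL

/-! Since `?` is comonoidal, the tensor product of `L` lifts to `?`-algebras. Every algebra `X`
inherits from the monoid `?X` a unit and a multiplication, transported along the split epimorphism
`X.a`. The key identity `mul_a` says that `X.a` respects multiplication; it makes every algebra
morphism a morphism for these operations and makes the operations themselves algebra morphisms. As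
the operations on a tensor product are componentwise (`w` and `c` are comonoidal), the dual of Fox's
theorem applies: the lifted tensor is the coproduct.

Cohoms of free algebras come from `L`: `Hom (?A, Y ⊗ B) ≅ Hom (A, UY ⊗ UB) ≅ Hom (A •- UB, UY) ≅ Hom
(?(A •- UB), Y)`. Cohoms of a coproduct are coproducts of cohoms, so finite coproducts of free
algebras are subtractable and form a coclosed subcategory. Subtractable algebras are closed under
cohoms because `(A •- B) •- B'` is `A •- (B' ⊗ B)`. The adjunction is comonoidal because the tensor
of algebras is computed in `L`. -/

/-- In a symmetric monoidal category, the tensor product of two monoids is generated by the images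
of the two factors. -/
lemma inl_tensor_inr_mul {C : Type u} [Category.{v} C] [MonoidalCategory C] [SymmetricCategory C]
    {X Y : C} (oX : 𝟙_ C ⟶ X) (oY : 𝟙_ C ⟶ Y) (mX : X ⊗ X ⟶ X) (mY : Y ⊗ Y ⟶ Y)
    (hX : X ◁ oX ≫ mX = (ρ_ X).hom) (hY : oY ▷ Y ≫ mY = (λ_ Y).hom) :
    (((ρ_ X).inv ≫ X ◁ oY) ⊗ₘ ((λ_ Y).inv ≫ oX ▷ Y)) ≫ tensorμ X Y X Y ≫ (mX ⊗ₘ mY) =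
      𝟙 (X ⊗ Y) := by
  -- The computation is `(x, 1) * (1, y) = (x, y)`: the two units slide through the middle
  -- interchange and cancel by `hX` and `hY`.
  have := tensorμ_natural (𝟙 X) oY oX (𝟙 Y)
  simp only [id_tensorHom, tensorHom_id] at this
  rw [← tensorHom_comp_tensorHom_assoc, reassoc_of% this, tensorHom_comp_tensorHom, hX, hY]
  simp only [tensorμ]
  rw [braiding_tensorUnit_left]
  monoidal

/-! ### The symmetric monoidal category of `?`-algebras. -/

namespace DualLinearCategory

open Functor.OplaxMonoidal

attribute [instance] comonoidal mon

variable {L : Type u} [Category.{v} L] [MonoidalCategory L] [SymmetricCategory L]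
  [MonoidalCoclosed L] (D : DualLinearCategory L)

lemma η_unit : D.whyNot.η.app (𝟙_ L) ≫ η D.whyNot.toFunctor = 𝟙 (𝟙_ L) :=
  D.unit_comonoidal.unit

lemma η_tensor (X Y : L) :
    D.whyNot.η.app (X ⊗ Y) ≫ δ D.whyNot.toFunctor X Y = D.whyNot.η.app X ⊗ₘ D.whyNot.η.app Y := by
  simpa using D.unit_comonoidal.tensor X Y

lemma μ_unit : D.whyNot.μ.app (𝟙_ L) ≫ η D.whyNot.toFunctor =
    D.whyNot.map (η D.whyNot.toFunctor) ≫ η D.whyNot.toFunctor :=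
  D.mult_comonoidal.unit

lemma μ_tensor (X Y : L) : D.whyNot.μ.app (X ⊗ Y) ≫ δ D.whyNot.toFunctor X Y =
    D.whyNot.map (δ D.whyNot.toFunctor X Y) ≫
      δ D.whyNot.toFunctor (D.whyNot.obj X) (D.whyNot.obj Y) ≫
        (D.whyNot.μ.app X ⊗ₘ D.whyNot.μ.app Y) := by
  simpa using D.mult_comonoidal.tensor X Y

lemma map_tensorHom_δ {X X' Y Y' : L} (f : X ⟶ Y) (g : X' ⟶ Y') :
    D.whyNot.map (f ⊗ₘ g) ≫ δ D.whyNot.toFunctor Y Y' =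
      δ D.whyNot.toFunctor X X' ≫ (D.whyNot.map f ⊗ₘ D.whyNot.map g) :=
  (δ_natural D.whyNot.toFunctor f g).symm

/-- The tensor product of two `?`-algebras. -/
def tensorAlgebra (X Y : D.whyNot.Algebra) : D.whyNot.Algebra where
  A := X.A ⊗ Y.A
  a := δ D.whyNot.toFunctor X.A Y.A ≫ (X.a ⊗ₘ Y.a)
  unit := by simp [reassoc_of% D.η_tensor, X.unit, Y.unit]
  assoc := by simp [reassoc_of% D.μ_tensor, reassoc_of% D.map_tensorHom_δ, X.assoc, Y.assoc]

/-- The unit object as a `?`-algebra. -/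
def unitAlgebra : D.whyNot.Algebra where
  A := 𝟙_ L
  a := η D.whyNot.toFunctor
  unit := D.η_unit
  assoc := D.μ_unit

lemma tensorHom_algebra {X X' Y Y' : D.whyNot.Algebra} (f : X ⟶ Y) (g : X' ⟶ Y') :
    D.whyNot.map (f.f ⊗ₘ g.f) ≫ δ D.whyNot.toFunctor Y.A Y'.A ≫ (Y.a ⊗ₘ Y'.a) =
      (δ D.whyNot.toFunctor X.A X'.A ≫ (X.a ⊗ₘ X'.a)) ≫ (f.f ⊗ₘ g.f) := by
  simp [reassoc_of% D.map_tensorHom_δ]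

lemma whiskerLeft_algebra (X : D.whyNot.Algebra) {Y Y' : D.whyNot.Algebra} (f : Y ⟶ Y') :
    D.whyNot.map (X.A ◁ f.f) ≫ δ D.whyNot.toFunctor X.A Y'.A ≫ (X.a ⊗ₘ Y'.a) =
      (δ D.whyNot.toFunctor X.A Y.A ≫ (X.a ⊗ₘ Y.a)) ≫ X.A ◁ f.f := by
  simpa using D.tensorHom_algebra (𝟙 X) f

lemma whiskerRight_algebra {X X' : D.whyNot.Algebra} (f : X ⟶ X') (Y : D.whyNot.Algebra) :
    D.whyNot.map (f.f ▷ Y.A) ≫ δ D.whyNot.toFunctor X'.A Y.A ≫ (X'.a ⊗ₘ Y.a) =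
      (δ D.whyNot.toFunctor X.A Y.A ≫ (X.a ⊗ₘ Y.a)) ≫ f.f ▷ Y.A := by
  simpa using D.tensorHom_algebra f (𝟙 Y)

/-- The coassociativity axiom of `?`, followed by the structure maps. The unitors and the braiding
below use the counit and symmetry axioms in the same way. -/
lemma associator_algebra (X Y Z : D.whyNot.Algebra) :
    D.whyNot.map (α_ X.A Y.A Z.A).hom ≫
      δ D.whyNot.toFunctor X.A (Y.A ⊗ Z.A) ≫
        (X.a ⊗ₘ (δ D.whyNot.toFunctor Y.A Z.A ≫ (Y.a ⊗ₘ Z.a))) =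
    (δ D.whyNot.toFunctor (X.A ⊗ Y.A) Z.A ≫
      ((δ D.whyNot.toFunctor X.A Y.A ≫ (X.a ⊗ₘ Y.a)) ⊗ₘ Z.a)) ≫ (α_ X.A Y.A Z.A).hom := by
  have h := oplax_associativity D.whyNot.toFunctor X.A Y.A Z.A
  rw [← Category.id_comp X.a, ← Category.id_comp Z.a, ← tensorHom_comp_tensorHom,
    ← tensorHom_comp_tensorHom, id_tensorHom, tensorHom_id, Category.id_comp, Category.id_comp,
    Category.assoc, Category.assoc, associator_naturality, reassoc_of% h]

lemma leftUnitor_algebra (X : D.whyNot.Algebra) :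
    D.whyNot.map (λ_ X.A).hom ≫ X.a =
      (δ D.whyNot.toFunctor (𝟙_ L) X.A ≫ (η D.whyNot.toFunctor ⊗ₘ X.a)) ≫ (λ_ X.A).hom := by
  rw [← left_unitality_hom]
  simp [MonoidalCategory.tensorHom_def]

lemma rightUnitor_algebra (X : D.whyNot.Algebra) :
    D.whyNot.map (ρ_ X.A).hom ≫ X.a =
      (δ D.whyNot.toFunctor X.A (𝟙_ L) ≫ (X.a ⊗ₘ η D.whyNot.toFunctor)) ≫ (ρ_ X.A).hom := by
  rw [← right_unitality_hom]
  simp [tensorHom_def']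

lemma braiding_algebra (X Y : D.whyNot.Algebra) :
    D.whyNot.map (β_ X.A Y.A).hom ≫ δ D.whyNot.toFunctor Y.A X.A ≫ (Y.a ⊗ₘ X.a) =
      (δ D.whyNot.toFunctor X.A Y.A ≫ (X.a ⊗ₘ Y.a)) ≫ (β_ X.A Y.A).hom := by
  rw [← reassoc_of% D.symmetric.braided]
  simp

instance : MonoidalCategory D.whyNot.Algebra where
  tensorObj := D.tensorAlgebra
  tensorHom f g :=
    { f := f.f ⊗ₘ g.f
      h := D.tensorHom_algebra f g }
  whiskerLeft X _ _ f :=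
    { f := X.A ◁ f.f
      h := D.whiskerLeft_algebra X f }
  whiskerRight f Y :=
    { f := f.f ▷ Y.A
      h := D.whiskerRight_algebra f Y }
  tensorUnit := D.unitAlgebra
  associator X Y Z := Monad.Algebra.isoMk (α_ X.A Y.A Z.A) (D.associator_algebra X Y Z)
  leftUnitor X := Monad.Algebra.isoMk (λ_ X.A) (D.leftUnitor_algebra X)
  rightUnitor X := Monad.Algebra.isoMk (ρ_ X.A) (D.rightUnitor_algebra X)
  tensorHom_def f g := Monad.Algebra.Hom.ext (tensorHom_def f.f g.f)
  id_tensorHom_id X Y := Monad.Algebra.Hom.ext (id_tensorHom_id X.A Y.A)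
  tensorHom_comp_tensorHom f₁ f₂ g₁ g₂ :=
    Monad.Algebra.Hom.ext (tensorHom_comp_tensorHom f₁.f f₂.f g₁.f g₂.f)
  whiskerLeft_id X Y := Monad.Algebra.Hom.ext (whiskerLeft_id X.A Y.A)
  id_whiskerRight X Y := Monad.Algebra.Hom.ext (id_whiskerRight X.A Y.A)
  associator_naturality f g h := Monad.Algebra.Hom.ext (associator_naturality f.f g.f h.f)
  leftUnitor_naturality f := Monad.Algebra.Hom.ext (leftUnitor_naturality f.f)
  rightUnitor_naturality f := Monad.Algebra.Hom.ext (rightUnitor_naturality f.f)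
  pentagon W X Y Z := Monad.Algebra.Hom.ext (pentagon W.A X.A Y.A Z.A)
  triangle X Y := Monad.Algebra.Hom.ext (triangle X.A Y.A)

instance : SymmetricCategory D.whyNot.Algebra where
  braiding X Y := Monad.Algebra.isoMk (β_ X.A Y.A) (D.braiding_algebra X Y)
  braiding_naturality_right X _ _ f :=
    Monad.Algebra.Hom.ext (BraidedCategory.braiding_naturality_right X.A f.f)
  braiding_naturality_left f Z :=
    Monad.Algebra.Hom.ext (BraidedCategory.braiding_naturality_left f.f Z.A)
  hexagon_forward X Y Z := Monad.Algebra.Hom.ext (BraidedCategory.hexagon_forward X.A Y.A Z.A)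
  hexagon_reverse X Y Z := Monad.Algebra.Hom.ext (BraidedCategory.hexagon_reverse X.A Y.A Z.A)
  symmetry X Y := Monad.Algebra.Hom.ext (SymmetricCategory.symmetry X.A Y.A)

/-! ### Canonical monoids on algebras. -/

/-- The unit of the canonical monoid structure on a `?`-algebra. -/
def algebraOne (X : D.whyNot.Algebra) : 𝟙_ L ⟶ X.A :=
  (MonObj.one : 𝟙_ L ⟶ D.whyNot.obj X.A) ≫ X.a

/-- The multiplication of the canonical monoid structure on a `?`-algebra. -/
def algebraMul (X : D.whyNot.Algebra) : X.A ⊗ X.A ⟶ X.A :=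
  (D.whyNot.η.app X.A ⊗ₘ D.whyNot.η.app X.A) ≫ MonObj.mul ≫ X.a

/-- The structure map of a `?`-algebra is compatible with the multiplications. -/
lemma mul_a (X : D.whyNot.Algebra) :
    (MonObj.mul : D.whyNot.obj X.A ⊗ D.whyNot.obj X.A ⟶ D.whyNot.obj X.A) ≫ X.a =
      (X.a ⊗ₘ X.a) ≫ D.algebraMul X := by
  -- `μ` is a morphism of free algebras `??X ⟶ ?X`, hence a monoid morphism; this is where
  -- `free_hom` enters. With `X.a ≫ η = η ≫ ?X.a` and naturality of `c`, the factor `?X.a ≫ X.a`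
  -- becomes `μ ≫ X.a`, and `η ≫ μ = 𝟙` finishes.
  have hμ := (D.free_hom (D.whyNot.adj.counit.app (D.whyNot.free.obj X.A))).mul_hom
  have h : (D.whyNot.adj.counit.app (D.whyNot.free.obj X.A)).f = D.whyNot.μ.app X.A := by
    simp only [Monad.adj_counit]
    rfl
  rw [h] at hμ
  change (MonObj.mul : D.whyNot.obj (D.whyNot.obj X.A) ⊗ _ ⟶ _) ≫ D.whyNot.μ.app X.A =
    (D.whyNot.μ.app X.A ⊗ₘ D.whyNot.μ.app X.A) ≫ MonObj.mul at hμ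
  have hη : X.a ≫ D.whyNot.η.app X.A = D.whyNot.η.app _ ≫ D.whyNot.map X.a :=
    D.whyNot.η.naturality X.a
  rw [algebraMul, tensorHom_comp_tensorHom_assoc, hη, ← tensorHom_comp_tensorHom_assoc,
    ← reassoc_of% D.c_natural X.a, ← X.assoc, reassoc_of% hμ, tensorHom_comp_tensorHom_assoc]
  simp

/-- The structure map of an algebra is a split epimorphism, tensored with itself. -/
def splitEpiTensor (X : D.whyNot.Algebra) : SplitEpi (X.a ⊗ₘ X.a) where
  section_ := D.whyNot.η.app X.A ⊗ₘ D.whyNot.η.app X.A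
  id := by simp [X.unit]

instance (X : D.whyNot.Algebra) : IsSplitEpi (X.a ⊗ₘ X.a) := ⟨⟨D.splitEpiTensor X⟩⟩

/-- Morphisms of `?`-algebras preserve the units of the canonical monoids. -/
lemma algebraOne_hom {X Y : D.whyNot.Algebra} (f : X ⟶ Y) :
    D.algebraOne X ≫ f.f = D.algebraOne Y := by
  rw [algebraOne, Category.assoc, ← f.h, reassoc_of% D.w_natural f.f, algebraOne]

/-- Morphisms of `?`-algebras preserve the multiplications of the canonical monoids. -/
lemma algebraMul_hom {X Y : D.whyNot.Algebra} (f : X ⟶ Y) :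
    D.algebraMul X ≫ f.f = (f.f ⊗ₘ f.f) ≫ D.algebraMul Y := by
  -- Precomposing with the split epimorphism moves the question to free algebras, where it is
  -- naturality of `c`.
  rw [← cancel_epi (X.a ⊗ₘ X.a), ← reassoc_of% D.mul_a, ← f.h, reassoc_of% D.c_natural f.f, mul_a]
  simp

lemma algebraOne_algebra (X : D.whyNot.Algebra) :
    D.whyNot.map (D.algebraOne X) ≫ X.a = η D.whyNot.toFunctor ≫ D.algebraOne X := by
  rw [algebraOne, Functor.map_comp, Category.assoc, ← X.assoc, reassoc_of% D.w_algebra]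

lemma algebraMul_algebra (X : D.whyNot.Algebra) :
    D.whyNot.map (D.algebraMul X) ≫ X.a =
      (δ D.whyNot.toFunctor X.A X.A ≫ (X.a ⊗ₘ X.a)) ≫ D.algebraMul X := by
  -- `?` preserves split epimorphisms, so the claim reduces to `c_algebra` on the free algebra.
  rw [← cancel_epi (D.whyNot.map (X.a ⊗ₘ X.a)), ← Functor.map_comp_assoc, ← D.mul_a,
    Functor.map_comp, Category.assoc, ← X.assoc, reassoc_of% D.c_algebra, mul_a,
    Category.assoc, reassoc_of% D.map_tensorHom_δ]
  simp only [tensorHom_comp_tensorHom_assoc, X.assoc]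

/-- The unit of the canonical monoid on an algebra, as a morphism of algebras. -/
def one (X : D.whyNot.Algebra) : 𝟙_ D.whyNot.Algebra ⟶ X where
  f := D.algebraOne X
  h := D.algebraOne_algebra X

/-- The multiplication of the canonical monoid on an algebra, as a morphism of algebras. -/
def mul (X : D.whyNot.Algebra) : X ⊗ X ⟶ X where
  f := D.algebraMul X
  h := D.algebraMul_algebra X

lemma one_comp {X Y : D.whyNot.Algebra} (f : X ⟶ Y) : D.one X ≫ f = D.one Y :=
  Monad.Algebra.Hom.ext (D.algebraOne_hom f)

lemma mul_comp {X Y : D.whyNot.Algebra} (f : X ⟶ Y) : D.mul X ≫ f = (f ⊗ₘ f) ≫ D.mul Y :=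
  Monad.Algebra.Hom.ext (D.algebraMul_hom f)

/-- Inserting `η ≫ X.a = 𝟙` lets `mul_a` replace this unit law by that of the monoid `?X`. -/
lemma one_whiskerRight_mul (X : D.whyNot.Algebra) :
    D.one X ▷ X ≫ D.mul X = (λ_ X).hom := by
  apply Monad.Algebra.Hom.ext
  change D.algebraOne X ▷ X.A ≫ D.algebraMul X = (λ_ X.A).hom
  have : D.algebraOne X ▷ X.A = (MonObj.one ⊗ₘ D.whyNot.η.app X.A) ≫ (X.a ⊗ₘ X.a) := by
    simp [algebraOne, X.unit]
  rw [this, Category.assoc, ← mul_a, MonoidalCategory.tensorHom_def', Category.assoc,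
    MonObj.one_mul_assoc, leftUnitor_naturality_assoc, X.unit]
  exact Category.comp_id _

lemma whiskerLeft_one_mul (X : D.whyNot.Algebra) :
    X ◁ D.one X ≫ D.mul X = (ρ_ X).hom := by
  apply Monad.Algebra.Hom.ext
  change X.A ◁ D.algebraOne X ≫ D.algebraMul X = (ρ_ X.A).hom
  have : X.A ◁ D.algebraOne X = (D.whyNot.η.app X.A ⊗ₘ MonObj.one) ≫ (X.a ⊗ₘ X.a) := by
    simp [algebraOne, X.unit]
  rw [this, Category.assoc, ← mul_a, MonoidalCategory.tensorHom_def, Category.assoc,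
    MonObj.mul_one_assoc, rightUnitor_naturality_assoc, X.unit]
  exact Category.comp_id _

lemma one_unit : D.one (𝟙_ D.whyNot.Algebra) = 𝟙 _ :=
  Monad.Algebra.Hom.ext D.w_comonoidal_unit

/-- Comonoidality of `c` and of `η`. -/
lemma mul_tensor (X Y : D.whyNot.Algebra) :
    D.mul (X ⊗ Y) = tensorμ X Y X Y ≫ (D.mul X ⊗ₘ D.mul Y) := by
  apply Monad.Algebra.Hom.ext
  change (D.whyNot.η.app (X.A ⊗ Y.A) ⊗ₘ D.whyNot.η.app (X.A ⊗ Y.A)) ≫ MonObj.mul ≫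
      δ D.whyNot.toFunctor X.A Y.A ≫ (X.a ⊗ₘ Y.a) =
    tensorμ X.A Y.A X.A Y.A ≫ (D.algebraMul X ⊗ₘ D.algebraMul Y)
  rw [reassoc_of% D.c_comonoidal_tensor, tensorHom_comp_tensorHom_assoc, D.η_tensor,
    tensorμ_natural_assoc, tensorHom_comp_tensorHom, tensorHom_comp_tensorHom]
  rfl

/-! ### The tensor product of algebras as a coproduct. -/

/-- The unit algebra is initial. -/
def isInitialUnit : IsInitial (𝟙_ D.whyNot.Algebra) :=
  IsInitial.ofUniqueHom D.one fun X m ↦ by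
    rw [← D.one_comp m, one_unit, Category.id_comp]

lemma inl_desc {X Y Z : D.whyNot.Algebra} (f : X ⟶ Z) (g : Y ⟶ Z) :
    ((ρ_ X).inv ≫ X ◁ D.one Y) ≫ (f ⊗ₘ g) ≫ D.mul Z = f := by
  rw [MonoidalCategory.tensorHom_def', Category.assoc, Category.assoc, ← whiskerLeft_comp_assoc,
    one_comp, whisker_exchange_assoc, whiskerLeft_one_mul, rightUnitor_naturality,
    Iso.inv_hom_id_assoc]

lemma inr_desc {X Y Z : D.whyNot.Algebra} (f : X ⟶ Z) (g : Y ⟶ Z) :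
    ((λ_ Y).inv ≫ D.one X ▷ Y) ≫ (f ⊗ₘ g) ≫ D.mul Z = g := by
  rw [MonoidalCategory.tensorHom_def, Category.assoc, Category.assoc, ← comp_whiskerRight_assoc,
    one_comp, ← whisker_exchange_assoc, one_whiskerRight_mul, leftUnitor_naturality,
    Iso.inv_hom_id_assoc]

/-- Uniqueness of the copairing: `m` preserves multiplication, and `X ⊗ Y` is generated by its two
factors. -/
lemma eq_desc {X Y Z : D.whyNot.Algebra} (m : X ⊗ Y ⟶ Z) :
    m = (((ρ_ X).inv ≫ X ◁ D.one Y) ≫ m ⊗ₘ ((λ_ Y).inv ≫ D.one X ▷ Y) ≫ m) ≫ D.mul Z := by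
  rw [← tensorHom_comp_tensorHom, Category.assoc, ← mul_comp, mul_tensor, Category.assoc,
    reassoc_of% inl_tensor_inr_mul (D.one X) (D.one Y) (D.mul X) (D.mul Y)
      (D.whiskerLeft_one_mul X) (D.one_whiskerRight_mul Y)]

/-- The tensor product of algebras is their coproduct. -/
def isCoproductTensor (X Y : D.whyNot.Algebra) :
    IsColimit (BinaryCofan.mk ((ρ_ X).inv ≫ X ◁ D.one Y) ((λ_ Y).inv ≫ D.one X ▷ Y)) :=
  BinaryCofan.IsColimit.mk _ (fun f g ↦ (f ⊗ₘ g) ≫ D.mul _) D.inl_desc D.inr_desc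
    (fun f g m hf hg ↦ by
      subst hf hg
      exact D.eq_desc m)

instance : Cocartesian D.whyNot.Algebra where
  isInitialUnit := D.isInitialUnit
  isCoproduct := D.isCoproductTensor

end DualLinearCategory

/-! ### Cocartesian categories and subtractability. -/

namespace Cocartesian

variable {C : Type u} [Category.{v} C] [MonoidalCategory C] [Cocartesian C]

instance hasFiniteCoproducts : HasFiniteCoproducts C := by
  have : HasInitial C := (isInitialUnit (C := C)).hasInitial
  have (X Y : C) : HasColimit (pair X Y) := ⟨⟨⟨_, isCoproduct X Y⟩⟩⟩
  have := hasBinaryCoproducts_of_hasColimit_pair C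
  exact hasFiniteCoproducts_of_has_binary_and_initial

/-- In a cocartesian category, the tensor product is the coproduct. -/
noncomputable def tensorIsoCoprod [HasBinaryCoproducts C] (X Y : C) : X ⊗ Y ≅ X ⨿ Y :=
  (isCoproduct X Y).coconePointUniqueUpToIso (colimit.isColimit (pair X Y))

lemma inl_tensorIsoCoprod [HasBinaryCoproducts C] (X Y : C) :
    (ρ_ X).inv ≫ X ◁ isInitialUnit.to Y ≫ (tensorIsoCoprod X Y).hom = coprod.inl :=
  (Category.assoc _ _ _).symm.trans ((isCoproduct X Y).comp_coconePointUniqueUpToIso_hom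
    (colimit.isColimit (pair X Y)) ⟨.left⟩)

lemma inr_tensorIsoCoprod [HasBinaryCoproducts C] (X Y : C) :
    (λ_ Y).inv ≫ isInitialUnit.to X ▷ Y ≫ (tensorIsoCoprod X Y).hom = coprod.inr :=
  (Category.assoc _ _ _).symm.trans ((isCoproduct X Y).comp_coconePointUniqueUpToIso_hom
    (colimit.isColimit (pair X Y)) ⟨.right⟩)

lemma whiskerRight_tensorIsoCoprod [HasBinaryCoproducts C] {X Y : C} (f : X ⟶ Y) (B : C) :
    f ▷ B ≫ (tensorIsoCoprod Y B).hom = (tensorIsoCoprod X B).hom ≫ coprod.map f (𝟙 B) := by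
  refine BinaryCofan.IsColimit.hom_ext (isCoproduct X B) ?_ ?_
  · change ((ρ_ X).inv ≫ X ◁ isInitialUnit.to B) ≫ f ▷ B ≫ _ =
      ((ρ_ X).inv ≫ X ◁ isInitialUnit.to B) ≫ _ ≫ coprod.map f (𝟙 B)
    rw [Category.assoc, Category.assoc, reassoc_of% inl_tensorIsoCoprod, coprod.inl_map,
      ← inl_tensorIsoCoprod, whisker_exchange_assoc, ← rightUnitor_inv_naturality_assoc]
  · change ((λ_ B).inv ≫ isInitialUnit.to X ▷ B) ≫ f ▷ B ≫ _ =
      ((λ_ B).inv ≫ isInitialUnit.to X ▷ B) ≫ _ ≫ coprod.map f (𝟙 B)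
    rw [Category.assoc, Category.assoc, reassoc_of% inr_tensorIsoCoprod, coprod.inr_map,
      Category.id_comp, ← comp_whiskerRight_assoc,
      isInitialUnit.hom_ext (isInitialUnit.to X ≫ f) (isInitialUnit.to Y), inr_tensorIsoCoprod]

/-- In a cocartesian category, the functor `- ⊗ B` is the functor `- ⨿ B`. -/
noncomputable def tensorRightIso [HasBinaryCoproducts C] (B : C) :
    tensorRight B ≅ coprod.functor.flip.obj B :=
  NatIso.ofComponents (fun Y ↦ tensorIsoCoprod Y B) fun f ↦ whiskerRight_tensorIsoCoprod f B

/-- Replaces the coproduct `⨿` by the tensor product, so that subtractability becomes pointwise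
existence of left adjoints. -/
lemma isSubtractable_iff [HasBinaryCoproducts C] (A : C) :
    IsSubtractable C A ↔ ∀ B : C, (tensorRight B).leftAdjointObjIsDefined A :=
  forall_congr' fun B ↦
    ⟨fun ⟨_, ⟨e⟩⟩ ↦
      (e.ofIso (Functor.isoWhiskerRight (tensorRightIso B).symm _)).isCorepresentable,
    fun ⟨_, ⟨e⟩⟩ ↦ (e.ofIso (Functor.isoWhiskerRight (tensorRightIso B) _)).isCorepresentable⟩

/-- A full subcategory closed under the unit and the tensor product is cocartesian. -/
instance fullSubcategory (P : ObjectProperty C) [P.IsMonoidal] :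
    Cocartesian P.FullSubcategory where
  isInitialUnit := IsInitial.ofUniqueHom (fun X ↦ ObjectProperty.homMk (isInitialUnit.to X.obj))
    (fun X m ↦ by ext; exact isInitialUnit.hom_ext _ _)
  isCoproduct X Y := BinaryCofan.IsColimit.mk _
    (fun {Z} f g ↦ ObjectProperty.homMk
      (BinaryCofan.IsColimit.desc (isCoproduct X.obj Y.obj) f.hom g.hom))
    (fun {Z} f g ↦ by
      ext
      exact BinaryCofan.IsColimit.inl_desc (isCoproduct X.obj Y.obj) f.hom g.hom)
    (fun {Z} f g ↦ by
      ext
      exact BinaryCofan.IsColimit.inr_desc (isCoproduct X.obj Y.obj) f.hom g.hom)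
    (fun {Z} f g m hf hg ↦ by
      subst hf hg
      ext
      refine BinaryCofan.IsColimit.hom_ext (isCoproduct X.obj Y.obj) ?_ ?_
      · exact (BinaryCofan.IsColimit.inl_desc (isCoproduct X.obj Y.obj) _ _).symm
      · exact (BinaryCofan.IsColimit.inr_desc (isCoproduct X.obj Y.obj) _ _).symm)

end Cocartesian

/-! ### Existence of internal cohoms. -/

section Cohom

variable {C : Type u₁} [Category.{v₁} C]

/-- If every internal cohom exists, then the category is coclosed. -/
@[reducible]
noncomputable def MonoidalCoclosed.ofLeftAdjointObjIsDefined [MonoidalCategory C]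
    (h : ∀ A B : C, (tensorRight B).leftAdjointObjIsDefined A) : MonoidalCoclosed C where
  cohom B :=
    have : (tensorRight B).IsRightAdjoint :=
      Functor.isRightAdjoint_of_leftAdjointObjIsDefined_eq_top (by ext A; simpa using h A B)
    (tensorRight B).leftAdjoint
  adj B :=
    have : (tensorRight B).IsRightAdjoint :=
      Functor.isRightAdjoint_of_leftAdjointObjIsDefined_eq_top (by ext A; simpa using h A B)
    Adjunction.ofIsRightAdjoint _

variable {L : Type u₂} [Category.{v₂} L]

/-- `Hom (F A, R Y) ≅ Hom (A, U (R Y))`, so the same object corepresents both. -/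
lemma leftAdjointObjIsDefined_obj {F : L ⥤ C} {U : C ⥤ L} (adj : F ⊣ U) (R : C ⥤ C) {A : L}
    (h : (R ⋙ U).leftAdjointObjIsDefined A) : R.leftAdjointObjIsDefined (F.obj A) := by
  obtain ⟨X, ⟨e⟩⟩ := h
  exact Functor.CorepresentableBy.isCorepresentable (X := X)
    { homEquiv {Y} := e.homEquiv.trans (adj.homEquiv A (R.obj Y)).symm
      homEquiv_comp g f := by
        dsimp
        erw [e.homEquiv_comp]
        exact adj.homEquiv_naturality_right_symm _ _ }

/-- Internal cohoms of `F A` exist if `F` is left adjoint to a functor into a coclosed category that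
preserves the tensor product. -/
lemma leftAdjointObjIsDefined_tensorRight_obj [MonoidalCategory C] [MonoidalCategory L]
    [MonoidalCoclosed L] {F : L ⥤ C} {U : C ⥤ L} (adj : F ⊣ U) (B : C)
    (e : tensorRight B ⋙ U ≅ U ⋙ tensorRight (U.obj B)) (A : L) :
    (tensorRight B).leftAdjointObjIsDefined (F.obj A) :=
  -- The corepresenting object is `F (A •- U B)`.
  leftAdjointObjIsDefined_obj adj _ (Functor.leftAdjointObjIsDefined_of_adjunction
    (((MonoidalCoclosed.adj (U.obj B)).comp adj).ofNatIsoRight e.symm) A)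

/-- The internal cohom of an object all of whose internal cohoms exist is again of this form. -/
lemma leftAdjointObjIsDefined_of_corepresentableBy [MonoidalCategory C] {A B X : C}
    (hA : ∀ B : C, (tensorRight B).leftAdjointObjIsDefined A)
    (e : (tensorRight B ⋙ coyoneda.obj (Opposite.op A)).CorepresentableBy X) (B' : C) :
    (tensorRight B').leftAdjointObjIsDefined X := by
  -- `Hom (X, Y ⊗ B') ≅ Hom (A, (Y ⊗ B') ⊗ B) ≅ Hom (A, Y ⊗ (B' ⊗ B))`.
  obtain ⟨Z, ⟨e'⟩⟩ := hA (B' ⊗ B)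
  refine Functor.CorepresentableBy.isCorepresentable (X := Z)
    { homEquiv {Y} := e'.homEquiv.trans
        ((Iso.homToEquiv (α_ Y B' B).symm).trans e.homEquiv.symm)
      homEquiv_comp {Y Y'} g f := ?_ }
  apply e.homEquiv.injective
  erw [e.homEquiv_comp]
  have h : e'.homEquiv (f ≫ g) = e'.homEquiv f ≫ g ▷ (B' ⊗ B) := e'.homEquiv_comp g f
  simp [h]

/-- Internal cohoms restrict to full subcategories. -/
lemma leftAdjointObjIsDefined_fullSubcategory [MonoidalCategory C] (P : ObjectProperty C)
    [P.IsMonoidal] (A B : P.FullSubcategory) {X : C} (hX : P X)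
    (e : (tensorRight B.obj ⋙ coyoneda.obj (Opposite.op A.obj)).CorepresentableBy X) :
    (tensorRight B).leftAdjointObjIsDefined A :=
  Functor.CorepresentableBy.isCorepresentable (X := ⟨X, hX⟩)
    { homEquiv {Y} := P.fullyFaithfulι.homEquiv.trans
        (e.homEquiv.trans (P.fullyFaithfulι.homEquiv (X := A) (Y := Y ⊗ B)).symm)
      homEquiv_comp {Y Y'} g f := by
        exact ObjectProperty.hom_ext _ (e.homEquiv_comp g.hom f.hom) }

end Cohom

/-! ### Finite coproducts of free algebras. -/

section FiniteCoproduct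

variable {L : Type u} [Category.{v} L] {T : Monad L}

/-- Allows any finite index type. Freeness is an equation `hf` because a family such as `Sum.elim`
consists of free algebras only propositionally. -/
lemma isFiniteCoproductOfFree_of_isColimit {I : Type} [Finite I] {A : I → L}
    {f : I → T.Algebra} (hf : f = fun i ↦ T.free.obj (A i)) {c : Cofan f} (hc : IsColimit c) :
    IsFiniteCoproductOfFree T c.pt := by
  subst hf
  obtain ⟨n, ⟨e⟩⟩ := Finite.exists_equiv_fin I
  exact ⟨n, fun i ↦ A (e.symm i), fun i ↦ c.inj (e.symm i),
    ⟨Cofan.isColimitEquivOfEquiv e.symm c hc⟩⟩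

lemma isFiniteCoproductOfFree_free (A : L) : IsFiniteCoproductOfFree T (T.free.obj A) :=
  isFiniteCoproductOfFree_of_isColimit (I := Unit) (A := fun _ ↦ A) rfl
    (c := Cofan.mk (T.free.obj A) fun _ ↦ 𝟙 _)
    (Cofan.IsColimit.mk _ (fun s ↦ s.inj ()) (by simp) (by
      intro s m h
      simpa using h ()))

lemma isFiniteCoproductOfFree_of_isInitial {X : T.Algebra} (hX : IsInitial X) :
    IsFiniteCoproductOfFree T X :=
  ⟨0, Fin.elim0, fun i ↦ i.elim0,
    ⟨Cofan.IsColimit.mk _ (fun s ↦ hX.to s.pt) (fun _ i ↦ i.elim0) fun _ _ _ ↦ hX.hom_ext _ _⟩⟩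

lemma isFiniteCoproductOfFree_of_isCoproduct {X Y : T.Algebra} (hX : IsFiniteCoproductOfFree T X)
    (hY : IsFiniteCoproductOfFree T Y) {c : BinaryCofan X Y} (hc : IsColimit c) :
    IsFiniteCoproductOfFree T c.pt := by
  obtain ⟨n, A, ι, ⟨h⟩⟩ := hX
  obtain ⟨m, A', ι', ⟨h'⟩⟩ := hY
  exact isFiniteCoproductOfFree_of_isColimit (A := Sum.elim A A')
    (funext <| by rintro (_ | _) <;> rfl) (Cofan.combPairIsColimit h h' hc)

end FiniteCoproduct

/-! ### Subtractable algebras and the dual LNL models. -/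

namespace DualLinearCategory

variable {L : Type u} [Category.{v} L] [MonoidalCategory L] [SymmetricCategory L]
  [MonoidalCoclosed L] (D : DualLinearCategory L)

lemma leftAdjointObjIsDefined_free (A : L) (B : D.whyNot.Algebra) :
    (tensorRight B).leftAdjointObjIsDefined (D.whyNot.free.obj A) :=
  leftAdjointObjIsDefined_tensorRight_obj D.whyNot.adj B
    (NatIso.ofComponents (fun Y ↦ Iso.refl (Y.A ⊗ B.A))
      (fun f ↦ (Category.comp_id (f.f ▷ B.A)).trans (Category.id_comp (f.f ▷ B.A)).symm)) A

lemma isSubtractable_free (A : L) :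
    IsSubtractable D.whyNot.Algebra (D.whyNot.free.obj A) :=
  (Cocartesian.isSubtractable_iff _).2 (D.leftAdjointObjIsDefined_free A)

/-- The cohom of a coproduct by `B` is the coproduct of the cohoms. -/
lemma isFiniteCoproductOfFree_le_isSubtractable :
    IsFiniteCoproductOfFree D.whyNot ≤ IsSubtractable D.whyNot.Algebra := by
  rintro X ⟨n, A, ι, ⟨hc⟩⟩
  rw [Cocartesian.isSubtractable_iff]
  exact fun B ↦ Functor.leftAdjointObjIsDefined_of_isColimit hc
    fun j ↦ D.leftAdjointObjIsDefined_free _ B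

instance isMonoidal_isFiniteCoproductOfFree :
    (IsFiniteCoproductOfFree D.whyNot).IsMonoidal where
  prop_unit := isFiniteCoproductOfFree_of_isInitial Cocartesian.isInitialUnit
  prop_tensor X Y hX hY :=
    isFiniteCoproductOfFree_of_isCoproduct hX hY (Cocartesian.isCoproduct X Y)

instance isMonoidal_isSubtractable : (IsSubtractable D.whyNot.Algebra).IsMonoidal where
  prop_unit := D.isFiniteCoproductOfFree_le_isSubtractable _ (ObjectProperty.prop_unit _)
  prop_tensor X Y hX hY := by
    rw [Cocartesian.isSubtractable_iff] at hX hY ⊢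
    exact fun B ↦ Functor.leftAdjointObjIsDefined_of_isColimit (Cocartesian.isCoproduct X Y) (by
      rintro (_ | _)
      · exact hX B
      · exact hY B)

variable (P : ObjectProperty D.whyNot.Algebra) (h : ∀ A : L, P (D.whyNot.free.obj A))

lemma freeForgetAdj_unit_app (A : L) :
    (freeForgetAdj D.whyNot P h).unit.app A = D.whyNot.η.app A := by
  simp [freeForgetAdj]
  rfl

lemma freeForgetAdj_counit_app (X : P.FullSubcategory) :
    ((freeForgetAdj D.whyNot P h).counit.app X).hom.f = X.obj.a := by
  simp [freeForgetAdj]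
  rfl

variable [P.IsMonoidal]

/-- The forgetful functor from a full subcategory of algebras strictly preserves the tensor
product. -/
@[reducible]
def forgetOplaxMonoidal : (P.ι ⋙ D.whyNot.forget).OplaxMonoidal where
  η := 𝟙 (𝟙_ L)
  δ X Y := 𝟙 (X.obj.A ⊗ Y.obj.A)
  δ_natural_left f X :=
    (Category.id_comp (f.hom.f ▷ X.obj.A)).trans (Category.comp_id (f.hom.f ▷ X.obj.A)).symm
  δ_natural_right X f :=
    (Category.id_comp (X.obj.A ◁ f.hom.f)).trans (Category.comp_id (X.obj.A ◁ f.hom.f)).symm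
  oplax_associativity X Y Z := by
    change 𝟙 ((X.obj.A ⊗ Y.obj.A) ⊗ Z.obj.A) ≫ 𝟙 (X.obj.A ⊗ Y.obj.A) ▷ Z.obj.A ≫ (α_ _ _ _).hom =
      (α_ X.obj.A Y.obj.A Z.obj.A).hom ≫ 𝟙 _ ≫ X.obj.A ◁ 𝟙 (Y.obj.A ⊗ Z.obj.A)
    simp
  oplax_left_unitality X := by
    change (λ_ X.obj.A).inv = (λ_ X.obj.A).inv ≫ 𝟙 _ ≫ 𝟙 (𝟙_ L) ▷ X.obj.A
    simp
  oplax_right_unitality X := by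
    change (ρ_ X.obj.A).inv = (ρ_ X.obj.A).inv ≫ 𝟙 _ ≫ X.obj.A ◁ 𝟙 (𝟙_ L)
    simp

/-- The free functor into a full subcategory of algebras is comonoidal. -/
@[reducible]
def freeOplaxMonoidal : (P.lift D.whyNot.free h).OplaxMonoidal where
  η := ObjectProperty.homMk
    { f := Functor.OplaxMonoidal.η D.whyNot.toFunctor
      h := D.μ_unit.symm }
  δ X Y := ObjectProperty.homMk
    { f := Functor.OplaxMonoidal.δ D.whyNot.toFunctor X Y
      -- Comonoidality of `μ` is exactly the condition that `δ` be an algebra morphism `?(X ⊗ Y) ⟶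
      -- ?X ⊗ ?Y`.
      h := (D.μ_tensor X Y).symm.trans rfl }
  δ_natural_left {X Y} f Z := by
    ext
    exact Functor.OplaxMonoidal.δ_natural_left D.whyNot.toFunctor f Z
  δ_natural_right Z f := by
    ext
    exact Functor.OplaxMonoidal.δ_natural_right D.whyNot.toFunctor Z f
  oplax_associativity X Y Z := by
    ext
    exact Functor.OplaxMonoidal.oplax_associativity D.whyNot.toFunctor X Y Z
  oplax_left_unitality X := by
    ext
    exact Functor.OplaxMonoidal.oplax_left_unitality D.whyNot.toFunctor X
  oplax_right_unitality X := by
    ext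
    exact Functor.OplaxMonoidal.oplax_right_unitality D.whyNot.toFunctor X

/-- The free/forgetful adjunction is symmetric comonoidal. -/
def symmetricComonoidalAdjunction :
    SymmetricComonoidalAdjunction (freeForgetAdj D.whyNot P h) :=
  letI := D.forgetOplaxMonoidal P
  letI := D.freeOplaxMonoidal P h
  { left := D.freeOplaxMonoidal P h
    right := D.forgetOplaxMonoidal P
    left_symmetric := ⟨fun X Y ↦ by
      ext
      exact D.symmetric.braided X Y⟩
    right_symmetric := ⟨fun X Y ↦
      (Category.id_comp (β_ X.obj.A Y.obj.A).hom).trans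
        (Category.comp_id (β_ X.obj.A Y.obj.A).hom).symm⟩
    unit_comonoidal :=
      { unit := by
          rw [freeForgetAdj_unit_app]
          change _ ≫ Functor.OplaxMonoidal.η D.whyNot.toFunctor ≫ 𝟙 (𝟙_ L) = 𝟙 (𝟙_ L)
          rw [Category.comp_id, η_unit]
        tensor X Y := by
          rw [freeForgetAdj_unit_app, freeForgetAdj_unit_app, freeForgetAdj_unit_app]
          change _ ≫ Functor.OplaxMonoidal.δ D.whyNot.toFunctor X Y ≫ 𝟙 _ = 𝟙 _ ≫ _
          rw [Category.comp_id, η_tensor]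
          exact (Category.id_comp _).symm }
    -- The counit at `X` is `X.a`, so both conditions restate how structure maps on the unit and on
    -- tensor products of algebras are defined.
    counit_comonoidal :=
      { unit := by
          ext
          change ((freeForgetAdj D.whyNot P h).counit.app (𝟙_ _)).hom.f ≫ 𝟙 (𝟙_ L) =
            D.whyNot.map (𝟙 (𝟙_ L)) ≫ Functor.OplaxMonoidal.η D.whyNot.toFunctor
          rw [freeForgetAdj_counit_app, CategoryTheory.Functor.map_id]
          exact (Category.comp_id _).trans (Category.id_comp _).symm
        tensor X Y := by
          ext
          change ((freeForgetAdj D.whyNot P h).counit.app (X ⊗ Y)).hom.f ≫ 𝟙 (X.obj.A ⊗ Y.obj.A) =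
            (D.whyNot.map (𝟙 (X.obj.A ⊗ Y.obj.A)) ≫
              Functor.OplaxMonoidal.δ D.whyNot.toFunctor X.obj.A Y.obj.A) ≫
            (((freeForgetAdj D.whyNot P h).counit.app X).hom.f ⊗ₘ
              ((freeForgetAdj D.whyNot P h).counit.app Y).hom.f)
          rw [freeForgetAdj_counit_app, freeForgetAdj_counit_app, freeForgetAdj_counit_app,
            CategoryTheory.Functor.map_id, Category.id_comp]
          exact Category.comp_id _ } }

/-- A full subcategory of algebras that contains the free algebras and is closed under finite
coproducts and internal cohoms is part of a dual LNL model. -/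
noncomputable def dualLNLModel
    (hP : ∀ A B : P.FullSubcategory, (tensorRight B).leftAdjointObjIsDefined A) :
    DualLNLModel (freeForgetAdj D.whyNot P h) where
  monoidal := inferInstance
  symmetric := inferInstance
  cocartesian := inferInstance
  coclosed := MonoidalCoclosed.ofLeftAdjointObjIsDefined hP
  comonoidal := D.symmetricComonoidalAdjunction P h

lemma leftAdjointObjIsDefined_isSubtractable
    (A B : (IsSubtractable D.whyNot.Algebra).FullSubcategory) :
    (tensorRight B).leftAdjointObjIsDefined A := by
  have hA := (Cocartesian.isSubtractable_iff _).1 A.property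
  obtain ⟨X, ⟨e⟩⟩ := hA B.obj
  exact leftAdjointObjIsDefined_fullSubcategory _ A B
    ((Cocartesian.isSubtractable_iff _).2 (leftAdjointObjIsDefined_of_corepresentableBy hA e)) e

/-- The argument for free algebras is repeated inside the subcategory: `?(A •- UB)` already lies
there, and a coproduct of free algebras remains one in the full subcategory. -/
lemma leftAdjointObjIsDefined_isFiniteCoproductOfFree
    (A B : (IsFiniteCoproductOfFree D.whyNot).FullSubcategory) :
    (tensorRight B).leftAdjointObjIsDefined A := by
  obtain ⟨n, X, ι, ⟨hc⟩⟩ := A.property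
  let F := (IsFiniteCoproductOfFree D.whyNot).lift D.whyNot.free isFiniteCoproductOfFree_free
  let c : Cofan fun i ↦ F.obj (X i) := Cofan.mk A fun i ↦ ObjectProperty.homMk (ι i)
  have hc' : IsColimit c := Cofan.IsColimit.mk _
    (fun s ↦ ObjectProperty.homMk (Cofan.IsColimit.desc hc fun i ↦ (s.inj i).hom))
    (fun s i ↦ by
      ext : 1
      exact Cofan.IsColimit.fac hc (fun i ↦ (s.inj i).hom) i)
    (fun s m hm ↦ by
      ext : 1
      refine Cofan.IsColimit.hom_ext hc _ _ fun i ↦ ?_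
      exact (congrArg (·.hom) (hm i)).trans
        (Cofan.IsColimit.fac hc (fun i ↦ (s.inj i).hom) i).symm)
  refine Functor.leftAdjointObjIsDefined_of_isColimit hc' fun j ↦ ?_
  exact leftAdjointObjIsDefined_tensorRight_obj
    (freeForgetAdj D.whyNot _ isFiniteCoproductOfFree_free) B
    (NatIso.ofComponents (fun Y ↦ Iso.refl (Y.obj.A ⊗ B.obj.A)) (fun f ↦
      (Category.comp_id (f.hom.f ▷ B.obj.A)).trans (Category.id_comp (f.hom.f ▷ B.obj.A)).symm))
    (X j.as)

end DualLinearCategory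

end DualLNL

theorem mainTheorem2 {L : Type u} [Category.{v} L] [MonoidalCategory L] [SymmetricCategory L]
    [DualLNL.MonoidalCoclosed L] (D : DualLNL.DualLinearCategory L) :
    ∃ _ : HasFiniteCoproducts D.whyNot.Algebra,
      DualLNL.IsFiniteCoproductOfFree D.whyNot ≤ DualLNL.IsSubtractable D.whyNot.Algebra ∧
      (∃ h : ∀ A : L, DualLNL.IsSubtractable D.whyNot.Algebra (D.whyNot.free.obj A),
        Nonempty (DualLNL.DualLNLModel (DualLNL.freeForgetAdj D.whyNot
          (DualLNL.IsSubtractable D.whyNot.Algebra) h))) ∧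
      (∃ h : ∀ A : L, DualLNL.IsFiniteCoproductOfFree D.whyNot (D.whyNot.free.obj A),
        Nonempty (DualLNL.DualLNLModel (DualLNL.freeForgetAdj D.whyNot
          (DualLNL.IsFiniteCoproductOfFree D.whyNot) h))) :=
  ⟨inferInstance, D.isFiniteCoproductOfFree_le_isSubtractable,
    ⟨D.isSubtractable_free, ⟨D.dualLNLModel _ _ D.leftAdjointObjIsDefined_isSubtractable⟩⟩,
    ⟨DualLNL.isFiniteCoproductOfFree_free,
      ⟨D.dualLNLModel _ _ D.leftAdjointObjIsDefined_isFiniteCoproductOfFree⟩⟩⟩
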